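/- A gyrogroup is a nonempty set $G$ with a binary operation $\oplus$ such that: there is a unique $0\in G$ with $0\oplus x=x=x\oplus 0$ for all $x\in G$; every $x\in G$ has a unique inverse $\ominus x\in G$ with $\ominus x\oplus x=0=x\oplus(\ominus x)$; for all $x,y\in G$ there is an automorphism $\mathrm{gyr}[x,y]$ of $(G,\oplus)$ with $x\oplus(y\oplus z)=(x\oplus y)\oplus \mathrm{gyr}[x,y](z)$ for all $z\in G$; and $\mathrm{gyr}[x\oplus y,y]=\mathrm{gyr}[x,y]$ for all $x,y\in G$. A strongly topological gyrogroup is a gyrogroup $G$ with a topology for which $\oplus\colon G\times G\to G$ and $\ominus\colon G\to G$ are continuous and for which $0$ has a neighborhood base $\mu$ with $\mathrm{gyr}[x,y](U)=U$ for all $U\in\mu$ and $x,y\in G$. A subgyrogroup of $G$ is a nonempty subset that is closed under $\oplus$ and is a gyrogroup under the restriction of $\oplus$. Every compact Hausdorff strongly topological gyrogroup $G$ has a suitable set, that is, there is a subset $S\subseteq G$ such that $S$ is discrete in the subspace topology, $S\cup\{0\}$ is closed in $G$, and the subgyrogroup generated by $S$ (the smallest subgyrogroup of $G$ containing $S$)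 is dense in $G$. -/

import Mathlib

/-- A gyrogroup, written additively: `x + y` is the gyrogroup operation `x ⊕ y`, `-x` is the
inverse `⊖x`, and `gyr x y` is the gyration, an automorphism of the groupoid `(G, ⊕)`.
The gyrations are determined by the operation, see `Gyrogroup.gyr_eq`, and the identity and
the inverses are unique, see `Gyrogroup.zero_unique` and `Gyrogroup.neg_unique`. -/
class Gyrogroup (G : Type*) extends Add G, Zero G, Neg G where
  zero_add' : ∀ x : G, 0 + x = x
  add_zero' : ∀ x : G, x + 0 = x
  neg_add' : ∀ x : G, -x + x = 0
  add_neg' : ∀ x : G, x + -x = 0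
  gyr : G → G → (G ≃+ G)
  gyr_assoc : ∀ x y z : G, x + (y + z) = (x + y) + gyr x y z
  gyr_loop : ∀ x y : G, gyr (x + y) y = gyr x y

namespace Gyrogroup

theorem add_left_inj' {G : Type*} [Gyrogroup G] {a b c : G} (h : a + b = a + c) : b = c := by
  have h1 : ∀ z : G, -a + (a + z) = gyr (-a) a z := fun z => by
    rw [gyr_assoc, neg_add', zero_add']
  have h2 : gyr (-a) a b = gyr (-a) a c := by rw [← h1, ← h1, h]
  exact (gyr (-a) a).injective h2

theorem neg_add_cancel' {G : Type*} [Gyrogroup G] (a b : G) : -a + (a + b) = b := by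
  have h0 : gyr 0 a b = b := by
    have h := gyr_assoc 0 a b
    rw [zero_add', zero_add'] at h
    exact (add_left_inj' h).symm
  have h1 : gyr (-a) a b = gyr 0 a b := by rw [← gyr_loop (-a) a, neg_add']
  rw [gyr_assoc, neg_add', zero_add', h1, h0]

theorem zero_unique {G : Type*} [Gyrogroup G] {e : G}
    (h : ∀ x : G, e + x = x ∧ x + e = x) : e = 0 := by
  rw [← add_zero' e, (h 0).1]

theorem neg_unique {G : Type*} [Gyrogroup G] {x y : G} (h : x + y = 0) : y = -x :=
  add_left_inj' (h.trans (add_neg' x).symm)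

theorem neg_neg' {G : Type*} [Gyrogroup G] (x : G) : -(-x) = x :=
  (neg_unique (neg_add' x)).symm

theorem add_neg_cancel' {G : Type*} [Gyrogroup G] (a b : G) : a + (-a + b) = b := by
  have h := neg_add_cancel' (-a) b
  rwa [neg_neg'] at h

theorem gyr_eq {G : Type*} [Gyrogroup G] (x y z : G) :
    gyr x y z = -(x + y) + (x + (y + z)) := by
  rw [gyr_assoc x y z, neg_add_cancel']

theorem gyr_symm_eq {G : Type*} [Gyrogroup G] (x y w : G) :
    (gyr x y).symm w = -y + (-x + ((x + y) + w)) := by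
  rw [AddEquiv.symm_apply_eq, gyr_eq, add_neg_cancel', add_neg_cancel', neg_add_cancel']

/-- A nonempty subset `H` is a subgyrogroup if it is closed under the operation, the gyrations
by elements of `H` restrict to bijections from `H` onto their images of `H` (they are
homomorphisms by their type), and `H` is a gyrogroup under the restricted operation.
See `isSubgyrogroup_iff` for a criterion. -/
structure IsSubgyrogroup {G : Type*} [Gyrogroup G] (H : Set G) : Prop where
  nonempty : H.Nonempty
  add_mem : ∀ x ∈ H, ∀ y ∈ H, x + y ∈ H
  gyr_bijOn : ∀ x ∈ H, ∀ y ∈ H, Set.BijOn (gyr x y) H (gyr x y '' H)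
  isGyrogroup : ∃ inst : Gyrogroup H, ∀ x y : H, ((inst.add x y : H) : G) = (x : G) + (y : G)

theorem isSubgyrogroup_iff {G : Type*} [Gyrogroup G] (H : Set G) :
    IsSubgyrogroup H ↔
      (0 : G) ∈ H ∧ (∀ x ∈ H, ∀ y ∈ H, x + y ∈ H) ∧ ∀ x ∈ H, -x ∈ H := by
  constructor
  · rintro ⟨-, hadd, -, inst, hinst⟩
    have hz : ((inst.zero : H) : G) = 0 := by
      have h : ((inst.add inst.zero inst.zero : H) : G) = ((inst.zero : H) : G) :=
        congrArg Subtype.val (inst.zero_add' inst.zero)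
      rw [hinst] at h
      exact add_left_inj' (h.trans (add_zero' _).symm)
    refine ⟨hz ▸ (inst.zero : H).2, hadd, fun x hx => ?_⟩
    have h : ((inst.add ⟨x, hx⟩ (inst.neg ⟨x, hx⟩) : H) : G) = ((inst.zero : H) : G) :=
      congrArg Subtype.val (inst.add_neg' ⟨x, hx⟩)
    rw [hinst, hz] at h
    rw [← neg_unique h]
    exact (inst.neg ⟨x, hx⟩).2
  · rintro ⟨h0, hadd, hneg⟩
    refine ⟨⟨0, h0⟩, hadd, fun x _ y _ => (gyr x y).injective.injOn.bijOn_image, ?_⟩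
    let _ : Add H := ⟨fun x y => ⟨x.1 + y.1, hadd _ x.2 _ y.2⟩⟩
    refine ⟨{ zero := ⟨0, h0⟩
              neg := fun x => ⟨-x.1, hneg _ x.2⟩
              zero_add' := fun x => Subtype.ext (zero_add' x.1)
              add_zero' := fun x => Subtype.ext (add_zero' x.1)
              neg_add' := fun x => Subtype.ext (neg_add' x.1)
              add_neg' := fun x => Subtype.ext (add_neg' x.1)
              gyr := fun x y =>
                { toFun := fun z => ⟨gyr x.1 y.1 z.1, by
                    rw [gyr_eq]
                    exact hadd _ (hneg _ (hadd _ x.2 _ y.2)) _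
                      (hadd _ x.2 _ (hadd _ y.2 _ z.2))⟩
                  invFun := fun w => ⟨(gyr x.1 y.1).symm w.1, by
                    rw [gyr_symm_eq]
                    exact hadd _ (hneg _ y.2) _ (hadd _ (hneg _ x.2) _
                      (hadd _ (hadd _ x.2 _ y.2) _ w.2))⟩
                  left_inv := fun z => Subtype.ext ((gyr x.1 y.1).symm_apply_apply z.1)
                  right_inv := fun z => Subtype.ext ((gyr x.1 y.1).apply_symm_apply z.1)
                  map_add' := fun z w => Subtype.ext (map_add (gyr x.1 y.1) z.1 w.1) }
              gyr_assoc := fun x y z => Subtype.ext (gyr_assoc x.1 y.1 z.1)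
              gyr_loop := fun x y => AddEquiv.ext fun z => Subtype.ext
                (DFunLike.congr_fun (gyr_loop x.1 y.1) z.1) }, fun x y => rfl⟩

/-- The subgyrogroup generated by `S`: the intersection of all subgyrogroups containing `S`. -/
def generated {G : Type*} [Gyrogroup G] (S : Set G) : Set G :=
  ⋂₀ {H : Set G | IsSubgyrogroup H ∧ S ⊆ H}

theorem isSubgyrogroup_generated {G : Type*} [Gyrogroup G] (S : Set G) :
    IsSubgyrogroup (generated S) := by
  rw [isSubgyrogroup_iff]
  refine ⟨fun H hH => ((isSubgyrogroup_iff H).1 hH.1).1, fun x hx y hy H hH => ?_,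
    fun x hx H hH => ?_⟩
  · exact hH.1.add_mem x (hx H hH) y (hy H hH)
  · exact ((isSubgyrogroup_iff H).1 hH.1).2.2 x (hx H hH)

/-- `S` is a suitable set for `G`: it is discrete in the subspace topology, the subgyrogroup it
generates is dense, and `S ∪ {0}` is closed. -/
structure IsSuitableSet {G : Type*} [Gyrogroup G] [TopologicalSpace G] (S : Set G) : Prop where
  discrete : DiscreteTopology S
  dense_generated : Dense (generated S)
  isClosed : IsClosed (S ∪ {0})

end Gyrogroup

/-- A topological gyrogroup: the operation is jointly continuous and the inverse is continuous. -/
class IsTopologicalGyrogroup (G : Type*) [Gyrogroup G] [TopologicalSpace G] : Prop where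
  continuous_add : Continuous fun p : G × G => p.1 + p.2
  continuous_neg : Continuous fun x : G => -x

/-- A strongly topological gyrogroup: a topological gyrogroup with a neighborhood base at `0`
whose members are invariant under all gyrations. -/
class IsStronglyTopologicalGyrogroup (G : Type*) [Gyrogroup G] [TopologicalSpace G] : Prop
    extends IsTopologicalGyrogroup G where
  exists_basis : ∃ μ : Set (Set G), (nhds (0 : G)).HasBasis (fun U : Set G => U ∈ μ) id ∧
    ∀ U ∈ μ, ∀ x y : G, Gyrogroup.gyr x y '' U = U

/-!
A strongly topological gyrogroup has many gyration-invariant closed subgyrogroups `M`, namely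
intersections of certain sequences of neighborhoods of `0` (`exists_isAdmissible_subset`). Such an
`M` need not be normal, but its left cosets partition `G`, and the sequence describes the
convergence to the base point of the coset space. Well-order these sequences as `U b`, and put
`N b = ⋂ i < b, ⋂ n, U i n`. The suitable set is built along the decreasing chain of the `N b`.

At stage `b`, compactness gives for each `n` a finite subset of `U b n ∩ N b` whose translates
`f + U b (n + 2)` cover `U b n ∩ N b`. Expanding a point of `N b` successively with respect to these
finite sets approximates it, modulo the next term of the chain, by elements of the subgyrogroup
generated; this holds for arbitrary representatives of the cosets, so no quotient gyrogroup is
required, and transfinite induction gives density (`eq_univ_of_forall_exists`).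

The finite sets of one stage converge to `0` only modulo the next term of the chain. Their points
are therefore replaced by coset representatives that are lexicographically as close to `0` as
possible with respect to all sequences `U c` (`exists_lex_mem`, `exists_reduced_representative`).
Transfinite induction then shows that the whole set has only finitely many points outside each
neighborhood of `0` (`finite_diff_of_reduced`), so that it is discrete apart from `0` and closed
together with `0`.
-/

open Set Filter Topology

namespace Gyrogroup

/-! ### Gyration-invariant subgyrogroups -/

section Algebra

variable {G : Type*} [Gyrogroup G]

theorem gyr_zero (a b : G) : gyr a b 0 = 0 := by
  refine add_left_inj' (a := gyr a b 0) ?_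
  rw [← map_add, add_zero', add_zero']

theorem gyr_neg (a b x : G) : gyr a b (-x) = -gyr a b x := by
  refine neg_unique ?_
  rw [← map_add, add_neg', gyr_zero]

theorem neg_add_add_eq_gyr (a b c : G) : -(a + b) + (a + c) = gyr a b (-b + c) := by
  rw [gyr_eq, add_neg_cancel']

theorem neg_add_eq_gyr (a b c : G) : -(a + b) + c = gyr a b (-b + (-a + c)) := by
  rw [← neg_add_add_eq_gyr, add_neg_cancel']

/-- Subgyrogroups stable under every gyration of the ambient gyrogroup, not only under the
gyrations by their own elements. Their left cosets partition the gyrogroup, as in a group. -/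
structure IsGyrInvariant (N : Set G) : Prop where
  zero_mem : (0 : G) ∈ N
  add_mem : ∀ x ∈ N, ∀ y ∈ N, x + y ∈ N
  neg_mem : ∀ x ∈ N, -x ∈ N
  gyr_mem : ∀ a b, ∀ x ∈ N, gyr a b x ∈ N

theorem IsGyrInvariant.iInter {κ : Sort*} {N : κ → Set G} (h : ∀ k, IsGyrInvariant (N k)) :
    IsGyrInvariant (⋂ k, N k) where
  zero_mem := mem_iInter.2 fun k => (h k).zero_mem
  add_mem x hx y hy := mem_iInter.2 fun k =>
    (h k).add_mem x (mem_iInter.1 hx k) y (mem_iInter.1 hy k)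
  neg_mem x hx := mem_iInter.2 fun k => (h k).neg_mem x (mem_iInter.1 hx k)
  gyr_mem a b x hx := mem_iInter.2 fun k => (h k).gyr_mem a b x (mem_iInter.1 hx k)

theorem neg_add_mem_of_neg_add_mem {N : Set G} (hN : ∀ a b, ∀ x ∈ N, gyr a b x ∈ N) {k l u : G}
    (h : -l + (-k + u) ∈ N) : -(k + l) + u ∈ N := by
  rw [neg_add_eq_gyr]
  exact hN _ _ _ h

theorem subset_generated (S : Set G) : S ⊆ generated S := subset_sInter fun _ hH => hH.2

end Algebra

/-! ### Lexicographic selection in compact spaces -/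

/-- Lexicographic selection: for a well-ordered family of closed sets `C j` in a compact space,
a nonempty closed set `A` has a point `y` that belongs to each `C j` as soon as some point of `A`
with the same memberships below `j` does. -/
theorem exists_lex_mem {X J : Type*} [TopologicalSpace X] [CompactSpace X] [LinearOrder J]
    [WellFoundedLT J] {C : J → Set X} (hC : ∀ j, IsClosed (C j)) {A : Set X} (hA : IsClosed A)
    (hne : A.Nonempty) :
    ∃ y ∈ A, ∀ j, ∀ z ∈ A, (∀ i < j, z ∈ C i ↔ y ∈ C i) → z ∈ C j → y ∈ C j := by
  classical
  -- `T j` says that `C j` still meets what the earlier successful choices have left of `A`.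
  obtain ⟨T, hT⟩ : ∃ T : J → Prop, ∀ j, T j ↔ ∃ z ∈ A, z ∈ C j ∧ ∀ i < j, T i → z ∈ C i := by
    let F : ∀ j : J, (∀ i, i < j → Prop) → Prop :=
      fun j P => ∃ z ∈ A, z ∈ C j ∧ ∀ (i : J) (h : i < j), P i h → z ∈ C i
    exact ⟨wellFounded_lt.fix F, fun j => by rw [wellFounded_lt.fix_eq F j]⟩
  have hfin : (A ∩ ⋂ j : {j // T j}, C j).Nonempty := by
    refine hA.isCompact.inter_iInter_nonempty _ (fun j => hC j) fun u => ?_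
    rcases u.eq_empty_or_nonempty with rfl | hu
    · simpa using hne
    · obtain ⟨z, hzA, hz, hzi⟩ := (hT _).1 (u.max' hu).2
      refine ⟨z, hzA, mem_iInter₂.2 fun i hi => ?_⟩
      rcases (u.le_max' i hi).lt_or_eq with h | h
      · exact hzi i h i.2
      · exact h ▸ hz
  obtain ⟨y, hyA, hy⟩ := hfin
  refine ⟨y, hyA, fun j z hzA hz hzj => ?_⟩
  exact mem_iInter.1 hy ⟨j, (hT j).2 ⟨z, hzA, hzj, fun i hi hTi =>
    (hz i hi).2 (mem_iInter.1 hy ⟨i, hTi⟩)⟩⟩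

/-- Compactness along a chain of closed sets; the auxiliary set `A` covers an empty index type. -/
theorem nonempty_iInter_of_antitone {X κ : Type*} [TopologicalSpace X] [CompactSpace X]
    [LinearOrder κ] {D : κ → Set X} {A : Set X} (hA : IsClosed A) (hA' : A.Nonempty)
    (hD : Antitone D) (hc : ∀ k, IsClosed (D k)) (hne : ∀ k, (A ∩ D k).Nonempty) :
    (A ∩ ⋂ k, D k).Nonempty := by
  rcases isEmpty_or_nonempty κ with h | h
  · simpa using hA'
  · rw [inter_iInter]
    refine IsCompact.nonempty_iInter_of_directed_nonempty_isCompact_isClosed _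
      (Antitone.directed_ge fun k l h => inter_subset_inter_right _ (hD h)) hne
      (fun k => (hA.inter (hc k)).isCompact) fun k => hA.inter (hc k)

/-! ### Stages of a family of sequences of sets -/

/-- The intersection of all members of all sequences `U i` with `i < b`. -/
def interBelow {X ι : Type*} [Preorder ι] (U : ι → ℕ → Set X) (b : ι) : Set X :=
  ⋂ i : Iio b, ⋂ n, U i n

/-- The intersection of all members of all sequences `U i` with `i ≤ b`. -/
def interUpTo {X ι : Type*} [Preorder ι] (U : ι → ℕ → Set X) (b : ι) : Set X :=
  ⋂ i : Iic b, ⋂ n, U i n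

theorem mem_interBelow {X ι : Type*} [Preorder ι] {U : ι → ℕ → Set X} {b : ι} {x : X} :
    x ∈ interBelow U b ↔ ∀ i < b, ∀ n, x ∈ U i n := by
  simp [interBelow]

theorem mem_interUpTo {X ι : Type*} [Preorder ι] {U : ι → ℕ → Set X} {b : ι} {x : X} :
    x ∈ interUpTo U b ↔ ∀ i ≤ b, ∀ n, x ∈ U i n := by
  simp [interUpTo]

section Topology

variable {G : Type*} [Gyrogroup G] [TopologicalSpace G]

/-! ### Gyration-invariant neighborhood sequences -/

theorem continuous_gyr [IsTopologicalGyrogroup G] (a b : G) : Continuous fun x => gyr a b x := by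
  have hadd (c : G) : Continuous fun x : G => c + x :=
    IsTopologicalGyrogroup.continuous_add.comp (by fun_prop : Continuous fun x : G => (c, x))
  simp_rw [gyr_eq]
  exact (hadd _).comp ((hadd a).comp (hadd b))

theorem continuous_gyr_symm [IsTopologicalGyrogroup G] (a b : G) :
    Continuous fun x => (gyr a b).symm x := by
  have hadd (c : G) : Continuous fun x : G => c + x :=
    IsTopologicalGyrogroup.continuous_add.comp (by fun_prop : Continuous fun x : G => (c, x))
  simp_rw [gyr_symm_eq]
  exact (hadd _).comp ((hadd _).comp (hadd _))

theorem continuous_neg_left_add [IsTopologicalGyrogroup G] (a : G) :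
    Continuous fun x : G => -a + x :=
  IsTopologicalGyrogroup.continuous_add.comp (by fun_prop : Continuous fun x : G => (-a, x))

theorem continuous_neg_add_right [IsTopologicalGyrogroup G] (a : G) :
    Continuous fun x : G => -x + a :=
  IsTopologicalGyrogroup.continuous_add.comp
    (IsTopologicalGyrogroup.continuous_neg.prodMk continuous_const)

/-- Decreasing sequences of gyration-invariant closed neighborhoods of `0`, starting with the
whole space, whose intersection `M` is a gyration-invariant subgyrogroup. The neighborhoods are
unions of left cosets of `M`, so that they come from the coset space of `M`; for compact `G` they
give a countable neighborhood base of `M` there. -/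
structure IsAdmissible (U : ℕ → Set G) : Prop where
  zero_eq : U 0 = univ
  isClosed : ∀ n, IsClosed (U n)
  mem_nhds : ∀ n, U n ∈ 𝓝 (0 : G)
  antitone : Antitone U
  gyr_mem : ∀ n a b, ∀ x ∈ U n, gyr a b x ∈ U n
  isGyrInvariant : IsGyrInvariant (⋂ n, U n)
  add_mem : ∀ n, ∀ x ∈ U n, ∀ m ∈ ⋂ n, U n, x + m ∈ U n
  add_mem' : ∀ n, ∀ m ∈ ⋂ n, U n, ∀ x ∈ U (n + 1), m + x ∈ U n

/-- Closed symmetric gyration-invariant neighborhoods of `0`. -/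
structure IsGoodNhd (A : Set G) : Prop where
  isClosed : IsClosed A
  mem_nhds : A ∈ 𝓝 (0 : G)
  gyr_mem_iff : ∀ a b x, gyr a b x ∈ A ↔ x ∈ A
  neg_mem : ∀ x ∈ A, -x ∈ A

theorem exists_isGoodNhd_subset [RegularSpace G] [IsStronglyTopologicalGyrogroup G] {W : Set G}
    (hW : W ∈ 𝓝 (0 : G)) : ∃ A : Set G, IsGoodNhd A ∧ A ⊆ W := by
  obtain ⟨μ, hμ, hgyr⟩ := IsStronglyTopologicalGyrogroup.exists_basis (G := G)
  obtain ⟨C, ⟨hC, hCc⟩, hCW⟩ := (closed_nhds_basis (0 : G)).mem_iff.1 hW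
  obtain ⟨U, hU, hUC⟩ := hμ.mem_iff.1 hC
  have hcont : Continuous fun x : G => -x := IsTopologicalGyrogroup.continuous_neg
  have hg (a b x : G) : gyr a b x ∈ closure U ↔ x ∈ closure U := by
    refine ⟨fun hx => ?_, fun hx => map_mem_closure (continuous_gyr a b) hx fun y hy => ?_⟩
    · rw [← (gyr a b).symm_apply_apply x]
      refine map_mem_closure (continuous_gyr_symm a b) hx fun y hy => ?_
      rw [← hgyr U hU a b] at hy
      obtain ⟨z, hz, rfl⟩ := hy
      rwa [AddEquiv.symm_apply_apply]
    · rw [← hgyr U hU a b]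
      exact mem_image_of_mem _ hy
  have hneg0 : -(0 : G) = 0 := (neg_unique (zero_add' 0)).symm
  have hn : closure U ∈ 𝓝 (0 : G) := mem_of_superset (hμ.mem_of_mem hU) subset_closure
  refine ⟨closure U ∩ (fun x => -x) ⁻¹' closure U,
    ⟨isClosed_closure.inter (isClosed_closure.preimage hcont), inter_mem hn ?_, ?_, ?_⟩,
    inter_subset_left.trans ((hCc.closure_subset_iff.2 hUC).trans hCW)⟩
  · exact hcont.continuousAt.preimage_mem_nhds (by rwa [hneg0])
  · intro a b x
    simp only [mem_inter_iff, mem_preimage, ← gyr_neg, hg]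
  · rintro x ⟨hx, hx'⟩
    exact ⟨hx', by simpa only [mem_preimage, neg_neg'] using hx⟩

theorem exists_isGoodNhd_add_subset [RegularSpace G] [IsStronglyTopologicalGyrogroup G]
    {W : Set G} (hW : W ∈ 𝓝 (0 : G)) :
    ∃ A : Set G, IsGoodNhd A ∧ ∀ x ∈ A, ∀ y ∈ A, x + y ∈ W := by
  have hc : Tendsto (fun p : G × G => p.1 + p.2) (𝓝 0 ×ˢ 𝓝 0) (𝓝 0) := by
    have h := (IsTopologicalGyrogroup.continuous_add (G := G)).tendsto (0, 0)
    simpa only [nhds_prod_eq, zero_add'] using h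
  obtain ⟨V, hV, hVW⟩ := mem_prod_same_iff.1 (hc hW)
  obtain ⟨A, hA, hAV⟩ := exists_isGoodNhd_subset hV
  exact ⟨A, hA, fun x hx y hy => hVW (mk_mem_prod (hAV hx) (hAV hy))⟩

theorem IsGoodNhd.zero_mem {A : Set G} (hA : IsGoodNhd A) : (0 : G) ∈ A :=
  mem_of_mem_nhds hA.mem_nhds

theorem exists_isAdmissible_subset [CompactSpace G] [T2Space G]
    [IsStronglyTopologicalGyrogroup G] {W : Set G} (hW : W ∈ 𝓝 (0 : G)) :
    ∃ U : ℕ → Set G, IsAdmissible U ∧ ∃ n, U n ⊆ W := by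
  have hstep (A : {A : Set G // IsGoodNhd A}) : ∃ B : {B : Set G // IsGoodNhd B},
      ∀ x ∈ B.1, ∀ y ∈ B.1, x + y ∈ A.1 ∩ W := by
    obtain ⟨B, hB, h⟩ := exists_isGoodNhd_add_subset (inter_mem A.2.mem_nhds hW)
    exact ⟨⟨B, hB⟩, h⟩
  choose f hf using hstep
  have huniv : IsGoodNhd (univ : Set G) :=
    ⟨isClosed_univ, univ_mem, fun _ _ _ => by simp only [mem_univ], fun _ _ => mem_univ _⟩
  let B : ℕ → Set G := fun n => (f^[n] ⟨univ, huniv⟩).1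
  have hB (n) : IsGoodNhd (B n) := (f^[n] ⟨univ, huniv⟩).2
  have hadd (n) : ∀ x ∈ B (n + 1), ∀ y ∈ B (n + 1), x + y ∈ B n ∩ W := by
    simp only [B, Function.iterate_succ_apply']
    exact hf _
  have hsub (n) : B (n + 1) ⊆ B n ∩ W := fun x hx => by
    simpa only [add_zero'] using hadd n x hx 0 (hB _).zero_mem
  have hanti : Antitone B := antitone_nat_of_succ_le fun n => (hsub n).trans inter_subset_left
  have hM : IsGyrInvariant (⋂ n, B n) :=
    { zero_mem := mem_iInter.2 fun n => (hB n).zero_mem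
      add_mem := fun x hx y hy => mem_iInter.2 fun n =>
        (hadd n x (mem_iInter.1 hx _) y (mem_iInter.1 hy _)).1
      neg_mem := fun x hx => mem_iInter.2 fun n => (hB n).neg_mem x (mem_iInter.1 hx n)
      gyr_mem := fun a b x hx => mem_iInter.2 fun n =>
        ((hB n).gyr_mem_iff a b x).2 (mem_iInter.1 hx n) }
  -- Saturating `B n` by the cosets of the intersection shifts the sequence by at most one.
  let U : ℕ → Set G := fun n => image2 (fun x y => x + y) (B n) (⋂ n, B n)
  have hBU (n) : B n ⊆ U n := fun x hx => ⟨x, hx, 0, hM.zero_mem, add_zero' x⟩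
  have hUB (n) : U (n + 1) ⊆ B n ∩ W := by
    rintro _ ⟨x, hx, m, hm, rfl⟩
    exact hadd n x hx m (mem_iInter.1 hm _)
  have hUM : ⋂ n, U n = ⋂ n, B n :=
    Subset.antisymm (subset_iInter fun n => (iInter_subset _ (n + 1)).trans
      ((hUB n).trans inter_subset_left)) (iInter_mono hBU)
  refine ⟨U, ⟨univ_subset_iff.1 (hBU 0), fun n => ?_,
    fun n => mem_of_superset (hB n).mem_nhds (hBU n), fun n m h => image2_subset_right (hanti h),
    ?_, hUM ▸ hM, ?_, ?_⟩, 1, (hUB 0).trans inter_subset_right⟩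
  · have hcM : IsCompact (⋂ n, B n) := (isClosed_iInter fun n => (hB n).isClosed).isCompact
    have := ((hB n).isClosed.isCompact.prod hcM).image
      (IsTopologicalGyrogroup.continuous_add (G := G))
    rw [image_prod fun x y : G => x + y] at this
    exact this.isClosed
  · rintro n a b _ ⟨x, hx, m, hm, rfl⟩
    exact ⟨_, ((hB n).gyr_mem_iff a b x).2 hx, _, hM.gyr_mem a b m hm, (map_add _ _ _).symm⟩
  · rw [hUM]
    rintro n _ ⟨x, hx, m, hm, rfl⟩ m' hm'
    refine ⟨x, hx, m + (gyr x m).symm m', hM.add_mem _ hm _ ?_, ?_⟩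
    · refine mem_iInter.2 fun k => ((hB k).gyr_mem_iff x m _).1 ?_
      rw [AddEquiv.apply_symm_apply]
      exact mem_iInter.1 hm' k
    · dsimp only
      rw [gyr_assoc, AddEquiv.apply_symm_apply]
  · rw [hUM]
    rintro n m hm _ ⟨x, hx, m', hm', rfl⟩
    exact ⟨m + x, (hadd n m (mem_iInter.1 hm _) x hx).1, _, hM.gyr_mem m x m' hm',
      (gyr_assoc m x m').symm⟩

theorem exists_finite_neg_add_mem [CompactSpace G] [IsTopologicalGyrogroup G] {P : Set G}
    (hP : IsClosed P) {V : Set G} (hV : V ∈ 𝓝 (0 : G)) :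
    ∃ F : Set G, F.Finite ∧ F ⊆ P ∧ ∀ w ∈ P, ∃ f ∈ F, -f + w ∈ V := by
  obtain ⟨t, htP⟩ := hP.isCompact.elim_nhds_subcover' (fun f _ => {w | -f + w ∈ V})
    fun f _ => (continuous_neg_left_add f).continuousAt.preimage_mem_nhds (by rwa [neg_add'])
  refine ⟨Subtype.val '' (t : Set P), t.finite_toSet.image _, ?_, fun w hw => ?_⟩
  · rintro _ ⟨x, -, rfl⟩
    exact x.2
  · obtain ⟨f, hf, hfw⟩ := mem_iUnion₂.1 (htP hw)
    exact ⟨f, mem_image_of_mem _ hf, hfw⟩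

/-! ### Well-ordered families of admissible sequences -/

section Family

variable {ι : Type*} [LinearOrder ι] {U : ι → ℕ → Set G}

theorem isGyrInvariant_interBelow (hU : ∀ i, IsAdmissible (U i)) (b : ι) :
    IsGyrInvariant (interBelow U b) :=
  .iInter fun i => (hU i).isGyrInvariant

theorem isGyrInvariant_interUpTo (hU : ∀ i, IsAdmissible (U i)) (b : ι) :
    IsGyrInvariant (interUpTo U b) :=
  .iInter fun i => (hU i).isGyrInvariant

theorem isClosed_interBelow (hU : ∀ i, IsAdmissible (U i)) (b : ι) :
    IsClosed (interBelow U b) :=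
  isClosed_iInter fun i => isClosed_iInter fun n => (hU i).isClosed n

theorem isClosed_interUpTo (hU : ∀ i, IsAdmissible (U i)) (b : ι) :
    IsClosed (interUpTo U b) :=
  isClosed_iInter fun i => isClosed_iInter fun n => (hU i).isClosed n

theorem add_mem_iff_of_mem_iInter {V : ℕ → Set G} (hV : IsAdmissible V) {n : ℕ} {x v : G}
    (hv : v ∈ ⋂ n, V n) : x + v ∈ V n ↔ x ∈ V n := by
  refine ⟨fun h => ?_, fun h => hV.add_mem n x h v hv⟩
  have h' := hV.add_mem n _ h (gyr x v (-v))
    (hV.isGyrInvariant.gyr_mem _ _ _ (hV.isGyrInvariant.neg_mem v hv))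
  rwa [← gyr_assoc, add_neg', add_zero'] at h'

variable [WellFoundedLT ι]

/-- Every left coset of `interUpTo U b` has a representative `y` that lies, at each later stage
`c`, as deep in the sequence `U c` as its coset of `interBelow U c` allows. These representatives
make simultaneous lifts of a convergent family through all the coset spaces converge again. -/
theorem exists_reduced_representative [CompactSpace G] [IsTopologicalGyrogroup G]
    (hU : ∀ i, IsAdmissible (U i)) (b : ι) (f : G) :
    ∃ y, -f + y ∈ interUpTo U b ∧
      ∀ c, b < c → ∀ v ∈ interBelow U c, ∀ n, y + v ∈ U c n → y ∈ U c n := by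
  obtain ⟨y, hy, hlex⟩ := exists_lex_mem (J := ι ×ₗ ℕ)
    (C := fun j => U (ofLex j).1 (ofLex j).2) (fun j => (hU _).isClosed _)
    (A := {y | -f + y ∈ interUpTo U b})
    ((isClosed_interUpTo hU b).preimage (continuous_neg_left_add f))
    ⟨f, by simpa only [mem_ofPred_eq, neg_add'] using (isGyrInvariant_interUpTo hU b).zero_mem⟩
  refine ⟨y, hy, fun c hbc v hv n => ?_⟩
  have hv' := mem_interBelow.1 hv
  have hyv : -f + (y + v) ∈ interUpTo U b := by
    have hN := isGyrInvariant_interUpTo hU b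
    rw [gyr_assoc]
    exact hN.add_mem _ hy _ (hN.gyr_mem _ _ _
      (mem_interUpTo.2 fun i hi => hv' i (hi.trans_lt hbc)))
  induction n using Nat.strong_induction_on with
  | _ n ih =>
    intro hn
    refine hlex (toLex (c, n)) (y + v) hyv (fun i hi => ?_) hn
    -- Below stage `c` the points `y` and `y + v` are in the same coset; at stage `c` the
    -- sequence is decreasing.
    rcases Prod.Lex.lt_iff.1 hi with h | ⟨h, h'⟩
    · exact add_mem_iff_of_mem_iInter (hU _) (mem_iInter.2 (hv' _ h))
    · dsimp only [ofLex_toLex] at h h' ⊢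
      rw [h]
      have hm := (hU c).antitone h'.le hn
      exact iff_of_true hm (ih _ h' hm)

/-- The convergence argument: a set of points, each associated with a stage `b`, is finite outside
each member of each sequence, if at stages before `b` its points lie in the whole sequence, at
stage `b` only finitely many points associated with `b` avoid a given member, and at later stages
each point is as deep as its coset allows. -/
theorem finite_diff_of_reduced [CompactSpace G] [IsTopologicalGyrogroup G]
    (hU : ∀ i, IsAdmissible (U i)) {S : ι → Set G}
    (hbelow : ∀ b, S b ⊆ interBelow U b) (hfin : ∀ b n, (S b \ U b n).Finite)
    (hred : ∀ b, ∀ y ∈ S b, ∀ c, b < c → ∀ v ∈ interBelow U c, ∀ n,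
      y + v ∈ U c n → y ∈ U c n) (c : ι) :
    ∀ n, ((⋃ b, S b) \ U c n).Finite := by
  induction c using WellFoundedLT.induction with
  | _ c ih =>
    intro n
    -- `O` consists of the points whose coset of `interBelow U c` meets the interior of `U c n`.
    let O : Set G := ⋃ v ∈ interBelow U c, (fun x => x + v) ⁻¹' interior (U c n)
    have hO : IsOpen O := isOpen_biUnion fun v _ => isOpen_interior.preimage
      (IsTopologicalGyrogroup.continuous_add.comp
        (by fun_prop : Continuous fun x : G => (x, v)))
    have hsub : (⋂ j : Iio c × ℕ, U j.1 j.2) ⊆ O := by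
      intro x hx
      have hx' : x ∈ interBelow U c :=
        mem_interBelow.2 fun i hi n => mem_iInter.1 hx (⟨i, hi⟩, n)
      refine mem_iUnion₂.2 ⟨-x, (isGyrInvariant_interBelow hU c).neg_mem x hx', ?_⟩
      rw [mem_preimage, add_neg']
      exact mem_interior_iff_mem_nhds.2 ((hU c).mem_nhds n)
    obtain ⟨t, ht⟩ : ∃ t : Finset (Iio c × ℕ), (⋂ j ∈ t, U j.1 j.2) ⊆ O := by
      obtain ⟨t, ht⟩ := hO.isClosed_compl.isCompact.elim_finite_subfamily_closed
        (fun j : Iio c × ℕ => U j.1 j.2) (fun j => (hU _).isClosed _)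
        (by rwa [← disjoint_iff_inter_eq_empty, disjoint_compl_left_iff_subset])
      exact ⟨t, by rwa [← disjoint_iff_inter_eq_empty, disjoint_compl_left_iff_subset] at ht⟩
    refine ((hfin c n).union (t.finite_toSet.biUnion fun j _ => ih j.1 j.1.2 j.2)).subset ?_
    rintro y ⟨hy, hyn⟩
    obtain ⟨b, hb⟩ := mem_iUnion.1 hy
    rcases lt_trichotomy b c with h | rfl | h
    · right
      by_contra hcon
      have hyO : y ∈ O := ht (mem_iInter₂.2 fun j hj => by
        by_contra hj'
        exact hcon (mem_iUnion₂.2 ⟨j, hj, hy, hj'⟩))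
      obtain ⟨v, hv, hyv⟩ := mem_iUnion₂.1 hyO
      exact hyn (hred b y hb c h v hv n (interior_subset hyv))
    · exact Or.inl ⟨hb, hyn⟩
    · exact absurd (mem_interBelow.1 (hbelow b hb) c h n) hyn

/-- The density argument: a closed subgyrogroup `K` is everything if at each stage `b` every point
of `U b n` in `interBelow U b` can be moved into `U b (n + 1)` by a point of `K` that lies in
`interBelow U b`. -/
theorem eq_univ_of_forall_exists [CompactSpace G] [T2Space G] [IsTopologicalGyrogroup G]
    (hU : ∀ i, IsAdmissible (U i)) (hsep : ∀ W ∈ 𝓝 (0 : G), ∃ i n, U i n ⊆ W)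
    {K : Set G} (hK : IsClosed K) (h0 : (0 : G) ∈ K) (hadd : ∀ x ∈ K, ∀ y ∈ K, x + y ∈ K)
    (h : ∀ b n, ∀ w ∈ U b n ∩ interBelow U b,
      ∃ k ∈ K, k ∈ interBelow U b ∧ -k + w ∈ U b (n + 1)) :
    K = univ := by
  have hne : K.Nonempty := ⟨0, h0⟩
  have hneg0 (x : G) : -0 + x = x := by
    have := neg_add_cancel' 0 x
    rwa [zero_add'] at this
  have hstage : ∀ b x, (K ∩ {k | -k + x ∈ interUpTo U b}).Nonempty := by
    intro b
    induction b using WellFoundedLT.induction with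
    | _ b ih =>
      intro x
      obtain ⟨k, hk, hkx⟩ := nonempty_iInter_of_antitone hK hne
        (D := fun i : Iio b => {k | -k + x ∈ interUpTo U i.1})
        (fun i j hij k hk => mem_interUpTo.2 fun l hl => mem_interUpTo.1 hk l (hl.trans hij))
        (fun i => (isClosed_interUpTo hU _).preimage (continuous_neg_add_right x))
        fun i => ih i i.2 x
      have hkb : -k + x ∈ interBelow U b :=
        mem_interBelow.2 fun i hi => mem_interUpTo.1 (mem_iInter.1 hkx ⟨i, hi⟩) i le_rfl
      have hN := isGyrInvariant_interBelow hU b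
      obtain ⟨l, hl, hlx⟩ := nonempty_iInter_of_antitone hK hne
        (D := fun n => {l | -l + (-k + x) ∈ U b n ∩ interBelow U b})
        (fun m n hmn l hl => ⟨(hU b).antitone hmn hl.1, hl.2⟩)
        (fun n => (((hU b).isClosed n).inter (isClosed_interBelow hU b)).preimage
          (continuous_neg_add_right _)) (fun n => by
          induction n with
          | zero => exact ⟨0, h0, by rw [(hU b).zero_eq]; exact mem_univ _, by rwa [hneg0]⟩
          | succ n ihn =>
            obtain ⟨l, hl, hln⟩ := ihn
            obtain ⟨k', hk', hk'N, hk'n⟩ := h b n _ hln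
            exact ⟨l + k', hadd l hl k' hk',
              neg_add_mem_of_neg_add_mem ((hU b).gyr_mem _) hk'n,
              neg_add_mem_of_neg_add_mem hN.gyr_mem
                (hN.add_mem _ (hN.neg_mem _ hk'N) _ hln.2)⟩)
      refine ⟨k + l, hadd k hk l hl, neg_add_mem_of_neg_add_mem
        (isGyrInvariant_interUpTo hU b).gyr_mem (mem_interUpTo.2 fun i hi n => ?_)⟩
      have hln := mem_iInter.1 hlx n
      rcases hi.lt_or_eq with hi | rfl
      · exact mem_interBelow.1 hln.2 i hi n
      · exact hln.1
  refine eq_univ_of_forall fun x => ?_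
  obtain ⟨k, hk, hkx⟩ := nonempty_iInter_of_antitone hK hne
    (D := fun b => {k | -k + x ∈ interUpTo U b})
    (fun i j hij k hk => mem_interUpTo.2 fun l hl => mem_interUpTo.1 hk l (hl.trans hij))
    (fun b => (isClosed_interUpTo hU _).preimage (continuous_neg_add_right x))
    fun b => hstage b x
  have hx : -k + x = 0 := by
    by_contra hcon
    obtain ⟨i, n, hin⟩ := hsep _ (isOpen_compl_singleton.mem_nhds (Ne.symm hcon))
    exact hin (mem_interUpTo.1 (mem_iInter.1 hkx i) i le_rfl n) rfl
  have := add_neg_cancel' k x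
  rw [hx, add_zero'] at this
  exact this ▸ hk

end Family

/-! ### Construction of the suitable set -/

theorem isSubgyrogroup_closure [IsTopologicalGyrogroup G] {H : Set G} (hH : IsSubgyrogroup H) :
    IsSubgyrogroup (closure H) := by
  rw [isSubgyrogroup_iff] at hH ⊢
  refine ⟨subset_closure hH.1, fun x hx y hy => ?_, fun x hx => ?_⟩
  · exact map_mem_closure₂ IsTopologicalGyrogroup.continuous_add hx hy hH.2.1
  · exact map_mem_closure IsTopologicalGyrogroup.continuous_neg hx hH.2.2

/-- A set accumulating only at `0` and generating a dense subgyrogroup becomes suitable when `0` is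
removed from it: discreteness excludes `0`, and generation does not need it. -/
theorem isSuitableSet_diff_zero [T2Space G] {S : Set G}
    (hfin : ∀ W ∈ 𝓝 (0 : G), (S \ W).Finite) (hdense : Dense (generated S)) :
    IsSuitableSet (S \ {0}) := by
  have hacc (x : G) (hx : x ≠ 0) : ∃ V : Set G, IsOpen V ∧ x ∈ V ∧ (S ∩ V).Finite := by
    obtain ⟨V, W, hV, hW, hxV, h0W, hVW⟩ := t2_separation hx
    exact ⟨V, hV, hxV, (hfin W (hW.mem_nhds h0W)).subset fun y hy =>
      ⟨hy.1, hVW.subset_compl_right hy.2⟩⟩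
  refine ⟨?_, ?_, ?_⟩
  · refine discreteTopology_subtype_iff'.2 fun x hx => ?_
    obtain ⟨V, hV, hxV, hf⟩ := hacc x hx.2
    have hf' : ((S ∩ V) \ {x}).Finite := hf.subset sdiff_subset
    refine ⟨V \ ((S ∩ V) \ {x}), hV.sdiff hf'.isClosed, Subset.antisymm ?_ ?_⟩
    · rintro y ⟨⟨hy, hy'⟩, hyS⟩
      by_contra hyx
      exact hy' ⟨⟨hyS.1, hy⟩, hyx⟩
    · rintro _ rfl
      exact ⟨⟨hxV, fun h => h.2 rfl⟩, hx⟩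
  · refine hdense.mono (subset_sInter fun H hH => ?_)
    refine sInter_subset_of_mem ⟨hH.1, fun x hx => ?_⟩
    by_cases h : x = 0
    · exact h ▸ ((isSubgyrogroup_iff H).1 hH.1).1
    · exact hH.2 ⟨hx, h⟩
  · rw [sdiff_union_self]
    refine isOpen_compl_iff.1 (isOpen_iff_mem_nhds.2 fun x hx => ?_)
    obtain ⟨V, hV, hxV, hf⟩ := hacc x fun h => hx (Or.inr h)
    filter_upwards [hV.mem_nhds hxV, isOpen_compl_singleton.mem_nhds fun h => hx (Or.inr h),
      hf.isClosed.isOpen_compl.mem_nhds fun h => hx (Or.inl h.1)] with y hy hy0 hyf hyS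
    exact hyS.elim (fun h => hyf ⟨h, hy⟩) hy0

theorem exists_isSuitableSet_of_family [CompactSpace G] [T2Space G] [IsTopologicalGyrogroup G]
    {ι : Type*} [LinearOrder ι] [WellFoundedLT ι] {U : ι → ℕ → Set G}
    (hU : ∀ i, IsAdmissible (U i)) (hsep : ∀ W ∈ 𝓝 (0 : G), ∃ i n, U i n ⊆ W) :
    ∃ S : Set G, IsSuitableSet S := by
  -- Passing to a representative costs one index, hence `n + 2` rather than `n + 1`.
  have hF (b n) := exists_finite_neg_add_mem
    (((hU b).isClosed n).inter (isClosed_interBelow hU b)) ((hU b).mem_nhds (n + 2))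
  choose F hFfin hFsub hFcov using hF
  choose r hr hred using fun b f => exists_reduced_representative hU b f
  have hN (b) := isGyrInvariant_interBelow hU b
  have hUpTo {b x} (hx : x ∈ interUpTo U b) : x ∈ interBelow U b ∧ x ∈ ⋂ n, U b n :=
    ⟨mem_interBelow.2 fun i hi => mem_interUpTo.1 hx i hi.le,
      mem_iInter.2 (mem_interUpTo.1 hx b le_rfl)⟩
  have hrmem (b n f) (hf : f ∈ F b n) : r b f ∈ U b n ∩ interBelow U b := by
    obtain ⟨hf1, hf2⟩ := hFsub b n hf
    obtain ⟨h1, h2⟩ := hUpTo (hr b f)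
    rw [← add_neg_cancel' f (r b f)]
    exact ⟨(hU b).add_mem n f hf1 _ h2, (hN b).add_mem _ hf2 _ h1⟩
  let S : ι → Set G := fun b => ⋃ n, r b '' F b n
  have hfin := finite_diff_of_reduced (S := S) hU
    (fun b => iUnion_subset fun n => by
      rintro _ ⟨f, hf, rfl⟩
      exact (hrmem b n f hf).2)
    (fun b n => by
      refine ((finite_lt_nat n).biUnion fun m _ => (hFfin b m).image (r b)).subset ?_
      rintro y ⟨hy, hyn⟩
      obtain ⟨m, f, hf, rfl⟩ := mem_iUnion.1 hy
      refine mem_iUnion₂.2 ⟨m, ?_, mem_image_of_mem _ hf⟩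
      by_contra hmn
      exact hyn ((hU b).antitone (not_lt.1 hmn) (hrmem b m f hf).1))
    (fun b y hy => by
      obtain ⟨m, f, -, rfl⟩ := mem_iUnion.1 hy
      exact hred b f)
  refine ⟨(⋃ b, S b) \ {0}, isSuitableSet_diff_zero (fun W hW => ?_) ?_⟩
  · obtain ⟨i, n, hin⟩ := hsep W hW
    exact (hfin i n).subset (sdiff_subset_sdiff_right hin)
  · have hK := (isSubgyrogroup_iff _).1
      (isSubgyrogroup_closure (isSubgyrogroup_generated (⋃ b, S b)))
    refine dense_iff_closure_eq.2
      (eq_univ_of_forall_exists hU hsep isClosed_closure hK.1 hK.2.1 fun b n w hw => ?_)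
    obtain ⟨f, hf, hfw⟩ := hFcov b n w hw
    refine ⟨r b f, subset_closure (subset_generated _ (mem_iUnion.2
      ⟨b, mem_iUnion.2 ⟨n, mem_image_of_mem _ hf⟩⟩)), (hrmem b n f hf).2, ?_⟩
    -- Write `r b f = f + m` and `w = f + v`; then `-(f + m) + (f + v)` is a gyration of `-m + v`.
    have hm := (hUpTo (hr b f)).2
    rw [← add_neg_cancel' f (r b f), ← add_neg_cancel' f w, neg_add_add_eq_gyr]
    exact (hU b).gyr_mem _ _ _ _ ((hU b).add_mem' _ _
      ((hU b).isGyrInvariant.neg_mem _ hm) _ hfw)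

end Topology

end Gyrogroup

theorem corollary22 (G : Type*) [Gyrogroup G] [TopologicalSpace G] [T2Space G] [CompactSpace G]
    [IsStronglyTopologicalGyrogroup G] : ∃ S : Set G, Gyrogroup.IsSuitableSet S := by
  let ι := {U : ℕ → Set G // Gyrogroup.IsAdmissible U}
  obtain ⟨_, _⟩ := exists_wellFoundedLT ι
  refine Gyrogroup.exists_isSuitableSet_of_family (ι := ι) (U := Subtype.val)
    (fun i => i.2) fun W hW => ?_
  obtain ⟨U, hU, n, hn⟩ := Gyrogroup.exists_isAdmissible_subset hW
  exact ⟨⟨U, hU⟩, n, hn⟩
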